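/- A weighted system $Az=b$ consists of $m$ linear equations over $\mathbb{F}_2$ in $n$ variables, each containing at least one variable and each having a positive integral weight. The excess of an assignment $z\in\mathbb{F}_2^n$ is the total weight of the satisfied equations minus the total weight of the falsified ones. The system is called irreducible if $\operatorname{rank}A=n$ and no two equations have the same left-hand side. An instance of Max Lin AA is a pair consisting of a weighted system and a parameter $k\in\mathbb{N}$, and the question is whether the maximum excess over all assignments is at least $k$. Systems are encoded as strings over a finite alphabet by listing the coefficients explicitly, and the weights and the parameter are written in binary. **Corollary.** Let $0<a<1$ be a constant, and let $p:\mathbb{N}\to\mathbb{R}$ be a fixed function with $p(n)=O(n^a)$. Then Max Lin AA, restricted to irreducible systems with $m<2^{p(n)}$, has a kernel with $O(k^{1/(1-a)})$ variables. That is, there is a polynomial-time algorithm that maps each instance $(x,k)$ of this restricted problem to an instance $(x',k')$ of the same restricted problem such that 1. $(x,k)$ is a yes-instance if and only if $(x',k')$ is a yes-instance; 2. $k'\le f(k)$ and $|x'|\le g(k)$ for some functions $f,g:\mathbb{N}\to\mathbb{N}$, where $|x'|$ is the length of the encoding of the system $x'$; 3. the number of variables of $x'$ is at most $h(k)$ for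 some function $h$ with $h(k)=O(k^{1/(1-a)})$. -/

import Mathlib

open Filter Asymptotics

/-- A weighted system `A z = b` of `m` linear equations in `n` variables over `𝔽₂` with positive
integral weights; every equation contains at least one variable. -/
structure MaxLinSystem where
  /-- number of variables -/
  n : ℕ
  /-- number of equations -/
  m : ℕ
  /-- coefficient matrix -/
  A : Matrix (Fin m) (Fin n) (ZMod 2)
  /-- right-hand sides -/
  b : Fin m → ZMod 2
  /-- weights -/
  w : Fin m → ℕ
  w_pos : ∀ j, 0 < w j
  row_ne_zero : ∀ j, A j ≠ 0

namespace MaxLinSystem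

/-- The excess of an assignment: the total weight of the satisfied equations minus the total weight
of the falsified equations. -/
def excess (S : MaxLinSystem) (z : Fin S.n → ZMod 2) : ℤ :=
  ∑ j, if S.A.mulVec z j = S.b j then (S.w j : ℤ) else -(S.w j : ℤ)

/-- The maximum excess over all assignments. -/
def maxExcess (S : MaxLinSystem) : ℤ :=
  Finset.univ.sup' ⟨0, Finset.mem_univ _⟩ S.excess

/-- Neither reduction rule changes the system: no variable can be deleted because the columns of
`A` are linearly independent (`rank A = n`), and no two equations can be merged because the
left-hand sides are pairwise distinct. -/
def Irreducible (S : MaxLinSystem) : Prop :=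
  S.A.rank = S.n ∧ ∀ i j, S.A i = S.A j → i = j

/-- The finite alphabet of the problem: the bits `some false`, `some true`, and a separator
`none`. -/
abbrev Symbol : Type := Option Bool

/-- The string describing one equation: the `n` coefficients, the right-hand side, a separator,
the weight in binary, a separator. -/
def encodeEquation (S : MaxLinSystem) (j : Fin S.m) : List Symbol :=
  (List.ofFn fun i => some (decide (S.A j i = 1))) ++ [some (decide (S.b j = 1)), none] ++
    (Computability.encodeNat (S.w j)).map some ++ [none]

/-- The string describing a system: the number of variables in unary, a separator, and the
equations one after another. -/
def encode (S : MaxLinSystem) : List Symbol :=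
  List.replicate S.n (some true) ++ [none] ++ (List.finRange S.m).flatMap S.encodeEquation

end MaxLinSystem

namespace MaxLinAA

/-- An instance of Max Lin AA restricted to irreducible systems with `m < 2 ^ p(n)`:
such a system together with the parameter `k`. -/
structure Instance (p : ℕ → ℝ) where
  /-- the system of equations -/
  system : MaxLinSystem
  /-- the parameter -/
  k : ℕ
  irreducible : system.Irreducible
  m_lt : (system.m : ℝ) < (2 : ℝ) ^ p system.n

variable {p : ℕ → ℝ}

/-- The question of Max Lin AA: is the maximum excess at least `k`? -/
def Instance.IsYes (I : Instance p) : Prop :=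
  (I.k : ℤ) ≤ I.system.maxExcess

/-- The string describing an instance: the parameter in binary, a separator, the system. -/
def Instance.encode (I : Instance p) : List MaxLinSystem.Symbol :=
  (Computability.encodeNat I.k).map some ++ [none] ++ I.system.encode

/-- A kernelization: a polynomial-time computable map `(x, k) ↦ (x', k')` from the problem to
itself that preserves the answer, such that `k' ≤ f(k)` and `|x'| ≤ g(k)` for some functions `f`
and `g`. -/
def IsKernelization (κ : Instance p → Instance p) : Prop :=
  Nonempty (Turing.TM2ComputableInPolyTime
    (Instance.encode (p := p)) (Instance.encode (p := p)) κ) ∧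
  (∀ I, I.IsYes ↔ (κ I).IsYes) ∧
  (∃ f : ℕ → ℕ, ∀ I, (κ I).k ≤ f I.k) ∧
  (∃ g : ℕ → ℕ, ∀ I, (κ I).system.encode.length ≤ g I.k)

end MaxLinAA

/-! The kernel returns a constant yes-instance when a cheap test certifies "yes", and the unchanged
instance otherwise.

The certificate is an averaging argument. For a set `K` of equations, weight each assignment by the
product of `1 + χ_i` over `K`, which vanishes unless all of `K` is satisfied. If `K` is independent
and spans no other left-hand side, orthogonality of characters makes the weighted mean of the excess
equal to the total weight of `K` (`sum_w_le_maxExcess`). A single equation is such a `K`, so a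
weight with more bits than `k` gives "yes". A shortest representation of a vector as a sum of rows
is also such a `K` (`card_le_maxExcess_of_minimal`); if `(m + 1) ^ k < 2 ^ n`, some vector is not a
sum of at most `k` rows, which again gives "yes" (`le_maxExcess_of_pow_lt`).

If the test fails, `n` is at most a constant times `(|p n| + 3) * (k + 1)`, and `p n = O(n ^ a)`
yields `n = O(k ^ (1 / (1 - a)))`. Then `m ≤ 2 ^ n` and the short weights bound the encoding. The
test compares only lengths and counts, so a machine with unary counters performs it in quadratic
time (`run_program`). -/

namespace MaxLinSystem

/-! ### Characters and the averaging bound on the excess -/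

/-- The character of `𝔽₂` with values `±1`. -/
def sign (x : ZMod 2) : ℤ := if x = 0 then 1 else -1

theorem sign_add : ∀ x y : ZMod 2, sign (x + y) = sign x * sign y := by decide

theorem sign_mul_self : ∀ x : ZMod 2, sign x * sign x = 1 := by decide

theorem one_add_sign_nonneg : ∀ x : ZMod 2, 0 ≤ 1 + sign x := by decide

theorem sign_sum {ι : Type*} (s : Finset ι) (f : ι → ZMod 2) :
    sign (∑ i ∈ s, f i) = ∏ i ∈ s, sign (f i) := by
  classical
  induction s using Finset.induction_on with
  | empty => simp [sign]
  | insert i s hi ih => rw [Finset.sum_insert hi, Finset.prod_insert hi, sign_add, ih]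

/-- Flipping a coordinate on which `v` is nonzero permutes the assignments and reverses every sign.
-/
theorem sum_sign_dotProduct {n : ℕ} {v : Fin n → ZMod 2} (hv : v ≠ 0) (c : ZMod 2) :
    ∑ z : Fin n → ZMod 2, sign (v ⬝ᵥ z + c) = 0 := by
  obtain ⟨i, hi⟩ := Function.ne_iff.1 hv
  have hi1 : v i = 1 := by
    have : ∀ x : ZMod 2, x ≠ 0 → x = 1 := by decide
    exact this _ hi
  have h := Equiv.sum_comp (Equiv.addRight (Pi.single i (1 : ZMod 2)))
    (fun z : Fin n → ZMod 2 => sign (v ⬝ᵥ z + c))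
  have h2 : ∀ z : Fin n → ZMod 2,
      sign (v ⬝ᵥ (Equiv.addRight (Pi.single i (1 : ZMod 2))) z + c) = -sign (v ⬝ᵥ z + c) := by
    intro z
    have : ∀ x y : ZMod 2, sign (x + 1 + y) = -sign (x + y) := by decide
    simp [dotProduct_add, hi1, this]
  simp only [h2, Finset.sum_neg_distrib] at h
  lia

variable (S : MaxLinSystem)

/-- The left-hand side of the `j`-th equation. -/
def row (j : Fin S.m) : Fin S.n → ZMod 2 := S.A j

theorem row_ne (j : Fin S.m) : S.row j ≠ 0 := S.row_ne_zero j

/-- The value `±1` that records whether the `j`-th equation is satisfied. -/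
def chi (j : Fin S.m) (z : Fin S.n → ZMod 2) : ℤ := sign (S.row j ⬝ᵥ z + S.b j)

theorem excess_eq_sum_chi (z : Fin S.n → ZMod 2) :
    S.excess z = ∑ j, (S.w j : ℤ) * S.chi j z := by
  refine Finset.sum_congr rfl fun j _ => ?_
  have : ∀ x y : ZMod 2, sign (x + y) = if x = y then 1 else -1 := by decide
  rw [chi, this]
  have hm : S.A.mulVec z j = S.row j ⬝ᵥ z := rfl
  simp only [hm]
  split_ifs <;> simp

theorem prod_chi (T : Finset (Fin S.m)) (z : Fin S.n → ZMod 2) :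
    ∏ i ∈ T, S.chi i z = sign ((∑ i ∈ T, S.row i) ⬝ᵥ z + ∑ i ∈ T, S.b i) := by
  simp only [chi, ← sign_sum, Finset.sum_add_distrib, sum_dotProduct]

/-- A nonnegative weight supported on the assignments satisfying all equations in `K`. -/
def weight (K : Finset (Fin S.m)) (z : Fin S.n → ZMod 2) : ℤ := ∏ i ∈ K, (1 + S.chi i z)

theorem weight_nonneg (K : Finset (Fin S.m)) (z : Fin S.n → ZMod 2) : 0 ≤ S.weight K z :=
  Finset.prod_nonneg fun _ _ => one_add_sign_nonneg _

theorem weight_mul_chi {K : Finset (Fin S.m)} {j : Fin S.m} (hj : j ∈ K)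
    (z : Fin S.n → ZMod 2) : S.weight K z * S.chi j z = S.weight K z := by
  rw [weight, ← Finset.mul_prod_erase K _ hj]
  have h : S.chi j z * S.chi j z = 1 := sign_mul_self _
  linear_combination (∏ i ∈ K.erase j, (1 + S.chi i z)) * h

/-- Expanding the product over subsets `T` of `K` leaves, for each `T`, the sum of a character that
`h` makes nontrivial. -/
theorem sum_weight_mul_chi_of_ne {K : Finset (Fin S.m)} {j : Fin S.m}
    (h : ∀ T ⊆ K, ∑ i ∈ T, S.row i ≠ S.row j) :
    ∑ z, S.weight K z * S.chi j z = 0 := by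
  simp only [weight, Finset.prod_one_add, Finset.sum_mul]
  rw [Finset.sum_comm]
  refine Finset.sum_eq_zero fun T hT => ?_
  rw [← sum_sign_dotProduct (v := ∑ i ∈ T, S.row i + S.row j) ?_ (∑ i ∈ T, S.b i + S.b j)]
  · refine Finset.sum_congr rfl fun z _ => ?_
    rw [prod_chi, chi, ← sign_add, add_dotProduct]
    congr 1
    ring
  · intro h0
    refine h T (Finset.mem_powerset.1 hT) ?_
    rw [eq_neg_of_add_eq_zero_left h0]
    ext i
    exact ZMod.neg_eq_self_mod_two _

theorem sum_weight {K : Finset (Fin S.m)} (h : ∀ T ⊆ K, ∑ i ∈ T, S.row i = 0 → T = ∅) :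
    ∑ z, S.weight K z = 2 ^ S.n := by
  simp only [weight, Finset.prod_one_add]
  rw [Finset.sum_comm, Finset.sum_eq_single_of_mem ∅ (Finset.empty_mem_powerset K)]
  · simp [ZMod.card]
  · intro T hT hne
    simp only [prod_chi]
    exact sum_sign_dotProduct (fun h0 => hne (h T (Finset.mem_powerset.1 hT) h0)) _

/-- If a set `K` of left-hand sides is linearly independent, and no left-hand side outside of `K`
is a sum of elements of `K`, then the maximum excess is at least the weight of `K`. -/
theorem sum_w_le_maxExcess {K : Finset (Fin S.m)}
    (h0 : ∀ T ⊆ K, ∑ i ∈ T, S.row i = 0 → T = ∅)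
    (h1 : ∀ T ⊆ K, ∀ j, ∑ i ∈ T, S.row i = S.row j → T = {j}) :
    ∑ j ∈ K, (S.w j : ℤ) ≤ S.maxExcess := by
  -- Under the weight, equations in `K` are always satisfied, and equations outside `K` average to
  -- zero.
  have key : ∑ z, S.weight K z * S.excess z = 2 ^ S.n * ∑ j ∈ K, (S.w j : ℤ) := by
    simp only [excess_eq_sum_chi, Finset.mul_sum]
    rw [Finset.sum_comm, ← Finset.sum_subset (Finset.subset_univ K)]
    · refine Finset.sum_congr rfl fun j hj => ?_
      rw [← S.sum_weight h0, Finset.sum_mul]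
      refine Finset.sum_congr rfl fun z _ => ?_
      conv_rhs => rw [← S.weight_mul_chi hj z]
      ring
    · intro j _ hj
      have := S.sum_weight_mul_chi_of_ne (K := K) (j := j) fun T hT hs => hj <| by
        have := h1 T hT j hs
        subst this
        simpa using hT
      calc _ = S.w j * ∑ z, S.weight K z * S.chi j z := by
            rw [Finset.mul_sum]
            exact Finset.sum_congr rfl fun z _ => by ring
        _ = 0 := by rw [this, mul_zero]
  have le : ∑ z, S.weight K z * S.excess z ≤ 2 ^ S.n * S.maxExcess := by
    rw [← S.sum_weight h0, Finset.sum_mul]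
    exact Finset.sum_le_sum fun z _ => mul_le_mul_of_nonneg_left
      (Finset.le_sup' S.excess (Finset.mem_univ z)) (S.weight_nonneg K z)
  rw [key] at le
  exact le_of_mul_le_mul_left le (by positivity)

/-! ### Lower bounds for irreducible systems -/

variable {S}

theorem Irreducible.row_injective (hS : S.Irreducible) {i j : Fin S.m}
    (h : S.row i = S.row j) : i = j := hS.2 i j h

theorem w_le_maxExcess (hS : S.Irreducible) (j : Fin S.m) : (S.w j : ℤ) ≤ S.maxExcess := by
  have := S.sum_w_le_maxExcess (K := {j}) ?_ ?_
  · simpa using this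
  · intro T hT hs
    rcases Finset.subset_singleton_iff.1 hT with rfl | rfl
    · rfl
    · exact absurd (by simpa using hs) (S.row_ne j)
  · intro T hT i hs
    rcases Finset.subset_singleton_iff.1 hT with rfl | rfl
    · exact absurd (by simpa using hs.symm) (S.row_ne i)
    · rw [hS.row_injective (i := j) (j := i) (by simpa using hs)]

/-- Rank `n` makes the rows span, and over `𝔽₂` a linear combination is a subset sum. -/
theorem exists_sum_rows (hS : S.Irreducible) (v : Fin S.n → ZMod 2) :
    ∃ T : Finset (Fin S.m), ∑ i ∈ T, S.row i = v := by
  have htop : Submodule.span (ZMod 2) (Set.range S.row) = ⊤ := by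
    apply Submodule.eq_top_of_finrank_eq
    have h := S.A.rank_eq_finrank_span_row
    rw [hS.1] at h
    rw [Module.finrank_fin_fun]
    exact h.symm
  have hv : v ∈ Submodule.span (ZMod 2) (Set.range S.row) := htop ▸ Submodule.mem_top
  obtain ⟨c, rfl⟩ := (Submodule.mem_span_range_iff_exists_fun (ZMod 2)).1 hv
  refine ⟨Finset.univ.filter fun j => c j = 1, ?_⟩
  rw [Finset.sum_filter]
  refine Finset.sum_congr rfl fun j _ => ?_
  have : ∀ x : ZMod 2, x = 1 ∨ x = 0 := by decide
  rcases this (c j) with h | h <;> simp [h]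

theorem sum_symmDiff {ι V : Type*} [DecidableEq ι] [AddCommGroup V] (h2 : ∀ v : V, v + v = 0)
    (s t : Finset ι) (f : ι → V) :
    ∑ i ∈ symmDiff s t, f i = ∑ i ∈ s, f i + ∑ i ∈ t, f i := by
  have h1 := Finset.sum_sdiff (f := f) (Finset.inter_subset_left (s₁ := s) (s₂ := t))
  have h3 := Finset.sum_sdiff (f := f) (Finset.inter_subset_right (s₁ := s) (s₂ := t))
  rw [Finset.sdiff_inter_self_left] at h1
  rw [Finset.sdiff_inter_self_right] at h3
  rw [symmDiff_def, Finset.sup_eq_union, Finset.sum_union disjoint_sdiff_sdiff, ← h1, ← h3,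
    add_add_add_comm, h2, add_zero]

/-- Minimality supplies both hypotheses of `sum_w_le_maxExcess`: a nonempty `T ⊆ K` with zero sum
could be deleted, and a `T` of size at least two that sums to row `j` could be replaced by `j`. Each
weight is at least one. -/
theorem card_le_maxExcess_of_minimal (hS : S.Irreducible) (K : Finset (Fin S.m))
    (hK : ∀ T : Finset (Fin S.m), ∑ i ∈ T, S.row i = ∑ i ∈ K, S.row i → K.card ≤ T.card) :
    (K.card : ℤ) ≤ S.maxExcess := by
  have h2 : ∀ v : Fin S.n → ZMod 2, v + v = 0 := fun v => by
    ext i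
    exact CharTwo.add_self_eq_zero _
  have h0 : ∀ T ⊆ K, ∑ i ∈ T, S.row i = 0 → T = ∅ := by
    intro T hT hs
    have h := hK (symmDiff K T) (by rw [sum_symmDiff h2, hs, add_zero])
    rw [symmDiff_of_ge hT, Finset.card_sdiff_of_subset hT] at h
    have := Finset.card_le_card hT
    exact Finset.card_eq_zero.1 (by lia)
  refine le_trans ?_ (S.sum_w_le_maxExcess h0 ?_)
  · rw [Finset.card_eq_sum_ones]
    push_cast
    exact Finset.sum_le_sum fun j _ => by exact_mod_cast S.w_pos j
  · intro T hT j hs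
    have h := hK (symmDiff (symmDiff K T) {j}) (by
      rw [sum_symmDiff h2, sum_symmDiff h2, hs, Finset.sum_singleton, add_assoc, h2, add_zero])
    -- Only an upper bound is available: `j` may already lie in `K \ T`, and then it cancels.
    have hc : (symmDiff (symmDiff K T) {j}).card ≤ (K \ T).card + 1 := by
      rw [symmDiff_of_ge hT]
      exact (Finset.card_le_card symmDiff_le_sup).trans (Finset.card_union_le _ _)
    rw [Finset.card_sdiff_of_subset hT] at hc
    have := Finset.card_le_card hT
    have hne : T.card ≠ 0 := by
      intro hT0
      rw [Finset.card_eq_zero.1 hT0, Finset.sum_empty] at hs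
      exact S.row_ne j hs.symm
    obtain ⟨i, rfl⟩ := Finset.card_eq_one.1 (show T.card = 1 by lia)
    rw [hS.row_injective (i := i) (j := j) (by simpa using hs)]

/-- Padding with `none` turns sets of size at most `k` into `k`-tuples, of which there are `(m + 1)
^ k` when `ι` has `m` elements. -/
theorem exists_sum_option {ι V : Type*} [AddCommMonoid V] (g : ι → V) {k : ℕ} (T : Finset ι)
    (hT : T.card ≤ k) : ∃ f : Fin k → Option ι, ∑ i, (f i).elim 0 g = ∑ i ∈ T, g i := by
  classical
  induction k generalizing T with
  | zero => exact ⟨fun _ => none, by simp [Finset.card_eq_zero.1 (Nat.le_zero.1 hT)]⟩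
  | succ k ih =>
    rcases T.eq_empty_or_nonempty with rfl | ⟨j, hj⟩
    · exact ⟨fun _ => none, by simp⟩
    · obtain ⟨f, hf⟩ := ih (T.erase j) (by rw [Finset.card_erase_of_mem hj]; lia)
      refine ⟨Fin.cons (some j) f, ?_⟩
      rw [Fin.sum_univ_succ]
      simp only [Fin.cons_zero, Fin.cons_succ, Option.elim_some, hf]
      exact Finset.add_sum_erase T g hj

/-- If there are few equations, then the maximum excess is large. -/
theorem le_maxExcess_of_pow_lt (hS : S.Irreducible) {k : ℕ} (h : (S.m + 1) ^ k < 2 ^ S.n) :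
    (k : ℤ) ≤ S.maxExcess := by
  classical
  obtain ⟨v, hv⟩ : ∃ v, ∀ f : Fin k → Option (Fin S.m), ∑ i, (f i).elim 0 S.row ≠ v := by
    by_contra! hcon
    have := Fintype.card_le_of_surjective
      (fun f : Fin k → Option (Fin S.m) => ∑ i, (f i).elim 0 S.row) hcon
    simp [ZMod.card] at this
    lia
  -- A representation of `v` of least size exists, and the choice of `v` forces that size above `k`.
  have hex : ∃ r, ∃ T : Finset (Fin S.m), ∑ i ∈ T, S.row i = v ∧ T.card = r := by
    obtain ⟨T, hT⟩ := exists_sum_rows hS v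
    exact ⟨_, T, hT, rfl⟩
  obtain ⟨K, hK, hr⟩ := Nat.find_spec hex
  refine le_trans ?_ (card_le_maxExcess_of_minimal hS K fun T hT => ?_)
  · by_contra! hlt
    obtain ⟨f, hf⟩ := exists_sum_option S.row (k := k) K (by lia)
    exact hv f (hf.trans hK)
  · rw [hr]
    exact Nat.find_min' hex ⟨T, hT.trans hK, rfl⟩

theorem m_le_two_pow (hS : S.Irreducible) : S.m ≤ 2 ^ S.n := by
  have := Fintype.card_le_of_injective S.row hS.2
  simpa [ZMod.card] using this

end MaxLinSystem

/-! ### The Turing machine and its single steps -/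

namespace MaxLinAA.KernelMachine

open MaxLinSystem (Symbol)

/-- The stacks of the machine: the input (and output), a reversed copy of the part of the input
read so far, three unary counters for the bits of the parameter, the variables and the separators,
and an auxiliary counter. -/
inductive Stack
  | inp | rev | bits | vars | seps | aux
  deriving DecidableEq

instance : Fintype Stack :=
  ⟨{.inp, .rev, .bits, .vars, .seps, .aux}, fun k => by cases k <;> decide⟩

/-- The labels of the machine. -/
inductive Label
  | readParam | readVars | readRow | readWeight | resetWeight
  | loop (second : Bool) | halve (second : Bool) | back (second : Bool)
  | test | drain | restore | clear
  deriving DecidableEq, Fintype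

open Turing.TM2.Stmt Label

/-- Statements of the machine; the internal state is the symbol popped last. -/
abbrev Stmt : Type := Turing.TM2.Stmt (fun _ : Stack => Symbol) Label (Option Symbol)

/-- Configurations of the machine. -/
abbrev Cfg : Type := Turing.TM2.Cfg (fun _ : Stack => Symbol) Label (Option Symbol)

/-- Reset the internal state and jump to a label. -/
def jump (l : Label) : Stmt := load (fun _ => none) (goto fun _ => l)

/-- Pop a symbol into the internal state. -/
def fetch (k : Stack) (q : Stmt) : Stmt := pop k (fun _ x => x) q

/-- Increment a unary counter. -/
def incr (k : Stack) (q : Stmt) : Stmt := push k (fun _ => none) q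

/-- Push the internal state. -/
def save (k : Stack) (q : Stmt) : Stmt := push k (fun s => s.getD none) q

/-- Test whether the symbol popped last is a bit. -/
def ifBit (q₁ q₂ : Stmt) : Stmt := branch (fun s => (s.getD none).isSome) q₁ q₂

/-- Test whether the stack popped last was nonempty. -/
def ifSome (q₁ q₂ : Stmt) : Stmt := branch Option.isSome q₁ q₂

/-- Pop a symbol, remembering whether any stack popped so far was nonempty. -/
def discard (k : Stack) (q : Stmt) : Stmt := pop k (fun s x => s.or x) q

/-- The stack that counts the passes of a halving loop. -/
def counter : Bool → Stack
  | false => .bits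
  | true => .vars

/-- The stack that is halved by a halving loop. -/
def target : Bool → Stack
  | false => .vars
  | true => .seps

/-- The label at which a halving loop is left. -/
def exit : Bool → Label
  | false => loop true
  | true => test

/-- The program. It counts the bits of the parameter, the variables and the separators, and checks
on the way that no weight is longer than the parameter. Then it halves the number of variables once
for each bit of the parameter, and the number of separators once for each unit of the result. The
input is replaced by a trivial instance if some weight is too long or no separator is left. -/
def program : Label → Stmt
  | readParam => fetch .inp <| save .rev <|
      ifBit (incr .bits <| jump readParam) (incr .seps <| jump readVars)
  | readVars => fetch .inp <| save .rev <|
      ifBit (incr .vars <| jump readVars) (incr .seps <| jump readRow)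
  | readRow => fetch .inp <| ifSome (save .rev <|
      ifBit (jump readRow) (incr .seps <| jump readWeight)) (jump (loop false))
  | readWeight => fetch .inp <| save .rev <|
      -- Each weight bit moves one unit from `bits` to `aux`; `resetWeight` moves them back for the
      -- next equation.
      ifBit (fetch .bits <| ifSome (incr .aux <| jump readWeight) (jump clear))
        (incr .seps <| jump resetWeight)
  | resetWeight => fetch .aux <| ifSome (incr .bits <| jump resetWeight) (jump readRow)
  | loop x => fetch (counter x) <| ifSome (jump (halve x)) (jump (exit x))
  -- The second pop overwrites the state of the first, so an odd leftover unit is lost and the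
  -- quotient is rounded down.
  | halve x => fetch (target x) <| fetch (target x) <|
      ifSome (incr .aux <| jump (halve x)) (jump (back x))
  | back x => fetch .aux <| ifSome (incr (target x) <| jump (back x)) (jump (loop x))
  | test => fetch .seps <| ifSome (jump drain) (jump clear)
  | drain => fetch .seps <| ifSome (jump drain) (jump restore)
  | restore => fetch .rev <| ifSome (save .inp <| jump restore) halt
  | clear => discard .inp <| discard .rev <| discard .bits <| discard .vars <| discard .seps <|
      -- The two separators written at the end encode the empty system with parameter `0`.
      discard .aux <| ifSome (jump clear) (incr .inp <| incr .inp halt)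

/-- The contents of the stacks. -/
def contents (I R : List Symbol) (b v s a : ℕ) : Stack → List Symbol
  | .inp => I
  | .rev => R
  | .bits => List.replicate b none
  | .vars => List.replicate v none
  | .seps => List.replicate s none
  | .aux => List.replicate a none

/-- A configuration between two steps. -/
def cfg (l : Label) (I R : List Symbol) (b v s a : ℕ) : Cfg := ⟨some l, none, contents I R b v s a⟩

/-- A final configuration. -/
def final (O : List Symbol) : Cfg := ⟨none, none, contents O [] 0 0 0 0⟩

/-- A configuration during a halving loop: `c` passes remain and `t` is being halved. -/
def loopCfg : Bool → Label → List Symbol → ℕ → ℕ → ℕ → ℕ → Cfg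
  | false, l, R, c, t, o, a => cfg l [] R c t o a
  | true, l, R, c, t, o, a => cfg l [] R o c t a

/-- The machine reaches `c'` from `c` in at most `t` steps. -/
def Run (t : ℕ) (c c' : Cfg) : Prop :=
  ∃ s ≤ t, (flip Bind.bind (Turing.TM2.step program))^[s] (some c) = some c'

theorem Run.trans {t t' : ℕ} {c c' c'' : Cfg} (h : Run t c c') (h' : Run t' c' c'') :
    Run (t + t') c c'' := by
  obtain ⟨s, hs, e⟩ := h
  obtain ⟨s', hs', e'⟩ := h'
  exact ⟨s' + s, by lia, by rw [Function.iterate_add_apply, e, e']⟩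

theorem Run.mono {t t' : ℕ} {c c' : Cfg} (h : Run t c c') (ht : t ≤ t') : Run t' c c' :=
  h.imp fun _ hs => ⟨hs.1.trans ht, hs.2⟩

theorem Run.of_step {c c' : Cfg} (h : Turing.TM2.step program c = some c') : Run 1 c c' :=
  ⟨1, le_rfl, h⟩

theorem Run.head {t : ℕ} {c c' c'' : Cfg} (h : Run 1 c c') (h' : Run t c' c'') :
    Run (t + 1) c c'' := (h.trans h').mono (by lia)

theorem cfg_congr {l : Option Label} {v : Option Symbol} {S S' : Stack → List Symbol}
    (h : ∀ k, S k = S' k) : (some ⟨l, v, S⟩ : Option Cfg) = some ⟨l, v, S'⟩ := by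
  rw [funext h]

variable (I R : List Symbol) (b v s a c t o : ℕ)

theorem step_readParam_bit (x : Bool) :
    Run 1 (cfg readParam (some x :: I) R b v s a) (cfg readParam I (some x :: R) (b + 1) v s a) :=
  .of_step (cfg_congr fun k => by cases k <;> rfl)

theorem step_readParam_sep :
    Run 1 (cfg readParam (none :: I) R b v s a) (cfg readVars I (none :: R) b v (s + 1) a) :=
  .of_step (cfg_congr fun k => by cases k <;> rfl)

theorem step_readVars_bit (x : Bool) :
    Run 1 (cfg readVars (some x :: I) R b v s a) (cfg readVars I (some x :: R) b (v + 1) s a) :=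
  .of_step (cfg_congr fun k => by cases k <;> rfl)

theorem step_readVars_sep :
    Run 1 (cfg readVars (none :: I) R b v s a) (cfg readRow I (none :: R) b v (s + 1) a) :=
  .of_step (cfg_congr fun k => by cases k <;> rfl)

theorem step_readRow_bit (x : Bool) :
    Run 1 (cfg readRow (some x :: I) R b v s a) (cfg readRow I (some x :: R) b v s a) :=
  .of_step (cfg_congr fun k => by cases k <;> rfl)

theorem step_readRow_sep :
    Run 1 (cfg readRow (none :: I) R b v s a) (cfg readWeight I (none :: R) b v (s + 1) a) :=
  .of_step (cfg_congr fun k => by cases k <;> rfl)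

theorem step_readRow_end : Run 1 (cfg readRow [] R b v s a) (cfg (loop false) [] R b v s a) :=
  .of_step (cfg_congr fun k => by cases k <;> rfl)

theorem step_readWeight_bit (x : Bool) :
    Run 1 (cfg readWeight (some x :: I) R (b + 1) v s a)
      (cfg readWeight I (some x :: R) b v s (a + 1)) :=
  .of_step (cfg_congr fun k => by cases k <;> rfl)

theorem step_readWeight_long (x : Bool) :
    Run 1 (cfg readWeight (some x :: I) R 0 v s a) (cfg clear I (some x :: R) 0 v s a) :=
  .of_step (cfg_congr fun k => by cases k <;> rfl)

theorem step_readWeight_sep :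
    Run 1 (cfg readWeight (none :: I) R b v s a) (cfg resetWeight I (none :: R) b v (s + 1) a) :=
  .of_step (cfg_congr fun k => by cases k <;> rfl)

theorem step_resetWeight_succ :
    Run 1 (cfg resetWeight I R b v s (a + 1)) (cfg resetWeight I R (b + 1) v s a) :=
  .of_step (cfg_congr fun k => by cases k <;> rfl)

theorem step_resetWeight_zero :
    Run 1 (cfg resetWeight I R b v s 0) (cfg readRow I R b v s 0) :=
  .of_step (cfg_congr fun k => by cases k <;> rfl)

theorem step_loop_succ (x : Bool) :
    Run 1 (loopCfg x (loop x) R (c + 1) t o a) (loopCfg x (halve x) R c t o a) := by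
  cases x <;> exact .of_step (cfg_congr fun k => by cases k <;> rfl)

theorem step_loop_zero (x : Bool) :
    Run 1 (loopCfg x (loop x) R 0 t o a) (loopCfg x (exit x) R 0 t o a) := by
  cases x <;> exact .of_step (cfg_congr fun k => by cases k <;> rfl)

theorem step_halve_add_two (x : Bool) :
    Run 1 (loopCfg x (halve x) R c (t + 2) o a) (loopCfg x (halve x) R c t o (a + 1)) := by
  cases x <;> exact .of_step (cfg_congr fun k => by cases k <;> rfl)

theorem step_halve_one (x : Bool) :
    Run 1 (loopCfg x (halve x) R c 1 o a) (loopCfg x (back x) R c 0 o a) := by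
  cases x <;> exact .of_step (cfg_congr fun k => by cases k <;> rfl)

theorem step_halve_zero (x : Bool) :
    Run 1 (loopCfg x (halve x) R c 0 o a) (loopCfg x (back x) R c 0 o a) := by
  cases x <;> exact .of_step (cfg_congr fun k => by cases k <;> rfl)

theorem step_back_succ (x : Bool) :
    Run 1 (loopCfg x (back x) R c t o (a + 1)) (loopCfg x (back x) R c (t + 1) o a) := by
  cases x <;> exact .of_step (cfg_congr fun k => by cases k <;> rfl)

theorem step_back_zero (x : Bool) :
    Run 1 (loopCfg x (back x) R c t o 0) (loopCfg x (loop x) R c t o 0) := by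
  cases x <;> exact .of_step (cfg_congr fun k => by cases k <;> rfl)

theorem step_test_succ : Run 1 (cfg test I R b v (s + 1) a) (cfg drain I R b v s a) :=
  .of_step (cfg_congr fun k => by cases k <;> rfl)

theorem step_test_zero : Run 1 (cfg test I R b v 0 a) (cfg clear I R b v 0 a) :=
  .of_step (cfg_congr fun k => by cases k <;> rfl)

theorem step_drain_succ : Run 1 (cfg drain I R b v (s + 1) a) (cfg drain I R b v s a) :=
  .of_step (cfg_congr fun k => by cases k <;> rfl)

theorem step_drain_zero : Run 1 (cfg drain I R b v 0 a) (cfg restore I R b v 0 a) :=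
  .of_step (cfg_congr fun k => by cases k <;> rfl)

theorem step_restore_cons (x : Symbol) :
    Run 1 (cfg restore I (x :: R) b v s a) (cfg restore (x :: I) R b v s a) :=
  .of_step (cfg_congr fun k => by cases k <;> rfl)

theorem step_restore_nil : Run 1 (cfg restore I [] 0 0 0 0) (final I) :=
  .of_step (cfg_congr fun k => by cases k <;> rfl)

theorem step_clear_zero : Run 1 (cfg clear [] [] 0 0 0 0) (final [none, none]) :=
  .of_step (cfg_congr fun k => by cases k <;> rfl)

/-- `tail` and truncated subtraction leave empty stacks empty, so all stacks can be popped together.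
-/
theorem step_clear (h : 0 < I.length + R.length + b + v + s + a) :
    Run 1 (cfg clear I R b v s a) (cfg clear I.tail R.tail (b - 1) (v - 1) (s - 1) (a - 1)) := by
  cases I <;> cases R <;> cases b <;> cases v <;> cases s <;> cases a <;>
    first
    | exact absurd h (lt_irrefl 0)
    | exact .of_step (cfg_congr fun k => by cases k <;> rfl)

end MaxLinAA.KernelMachine

/-! ### Running times of the loops and of the whole program -/

namespace MaxLinAA.KernelMachine

open MaxLinSystem (Symbol)
open Label

theorem run_clear (t : ℕ) (I R : List Symbol) (b v s a : ℕ) (hI : I.length ≤ t)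
    (hR : R.length ≤ t) (hb : b ≤ t) (hv : v ≤ t) (hs : s ≤ t) (ha : a ≤ t) :
    Run (t + 1) (cfg clear I R b v s a) (final [none, none]) := by
  induction t generalizing I R b v s a with
  | zero =>
    obtain rfl := List.eq_nil_of_length_eq_zero (Nat.le_zero.1 hI)
    obtain rfl := List.eq_nil_of_length_eq_zero (Nat.le_zero.1 hR)
    obtain ⟨rfl, rfl, rfl, rfl⟩ : b = 0 ∧ v = 0 ∧ s = 0 ∧ a = 0 := by lia
    exact step_clear_zero
  | succ t ih =>
    rcases Nat.eq_zero_or_pos (I.length + R.length + b + v + s + a) with h | h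
    · obtain rfl := List.eq_nil_of_length_eq_zero (l := I) (by lia)
      obtain rfl := List.eq_nil_of_length_eq_zero (l := R) (by lia)
      obtain ⟨rfl, rfl, rfl, rfl⟩ : b = 0 ∧ v = 0 ∧ s = 0 ∧ a = 0 := by lia
      exact step_clear_zero.mono (by lia)
    · refine (step_clear I R b v s a h).head (ih _ _ _ _ _ _ ?_ ?_ ?_ ?_ ?_ ?_)
      · rw [List.length_tail]; lia
      · rw [List.length_tail]; lia
      all_goals lia

theorem run_restore (I R : List Symbol) :
    Run (R.length + 1) (cfg restore I R 0 0 0 0) (final (R.reverse ++ I)) := by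
  induction R generalizing I with
  | nil => exact step_restore_nil I
  | cons x R ih => simpa using (step_restore_cons I R 0 0 0 0 x).head (ih (x :: I))

theorem run_drain (R : List Symbol) (s : ℕ) :
    Run (s + 1) (cfg drain [] R 0 0 s 0) (cfg restore [] R 0 0 0 0) := by
  induction s with
  | zero => exact step_drain_zero [] R 0 0 0
  | succ s ih => exact (step_drain_succ [] R 0 0 s 0).head ih

theorem run_back (R : List Symbol) (x : Bool) (c t o a : ℕ) :
    Run (a + 1) (loopCfg x (back x) R c t o a) (loopCfg x (loop x) R c (t + a) o 0) := by
  induction a generalizing t with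
  | zero => exact step_back_zero R c t o x
  | succ a ih =>
    have := (step_back_succ R a c t o x).head (ih (t + 1))
    rwa [add_right_comm t] at this

theorem run_halve (R : List Symbol) (x : Bool) (c t o a : ℕ) :
    Run (t / 2 + 1) (loopCfg x (halve x) R c t o a)
      (loopCfg x (back x) R c 0 o (a + t / 2)) := by
  induction t using Nat.twoStepInduction generalizing a with
  | zero => exact step_halve_zero R a c o x
  | one => exact step_halve_one R a c o x
  | more t ih _ =>
    have := (step_halve_add_two R a c t o x).head (ih (a + 1))
    rw [show (t + 2) / 2 = t / 2 + 1 by lia]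
    rwa [add_right_comm a, add_assoc a] at this

/-- One pass costs at most `t + 3` steps: one to enter, and `t / 2 + 1` each for halving and for
moving back. -/
theorem run_loop (R : List Symbol) (x : Bool) (c t o : ℕ) :
    Run (c * (t + 3) + 1) (loopCfg x (loop x) R c t o 0)
      (loopCfg x (exit x) R 0 (t / 2 ^ c) o 0) := by
  induction c generalizing t with
  | zero => simpa using step_loop_zero R 0 t o x
  | succ c ih =>
    have h := ((step_loop_succ R 0 c t o x).trans (run_halve R x c t o 0)).trans
      ((run_back R x c 0 o (0 + t / 2)).trans (by simpa using ih (t / 2)))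
    rw [Nat.div_div_eq_div_mul, ← pow_succ'] at h
    refine h.mono ?_
    have : c * (t / 2 + 3) ≤ c * (t + 3) := Nat.mul_le_mul_left _ (by lia)
    rw [add_mul]
    lia

theorem run_readParam (l : List Bool) (I R : List Symbol) (b v s a : ℕ) :
    Run (l.length + 1) (cfg readParam (l.map some ++ none :: I) R b v s a)
      (cfg readVars I (none :: (l.map some).reverse ++ R) (b + l.length) v (s + 1) a) := by
  induction l generalizing R b with
  | nil => exact step_readParam_sep I R b v s a
  | cons x l ih =>
    have := (step_readParam_bit (l.map some ++ none :: I) R b v s a x).head (ih (some x :: R) _)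
    simpa [add_assoc, add_comm 1] using this

theorem run_readVars (l : List Bool) (I R : List Symbol) (b v s a : ℕ) :
    Run (l.length + 1) (cfg readVars (l.map some ++ none :: I) R b v s a)
      (cfg readRow I (none :: (l.map some).reverse ++ R) b (v + l.length) (s + 1) a) := by
  induction l generalizing R v with
  | nil => exact step_readVars_sep I R b v s a
  | cons x l ih =>
    have := (step_readVars_bit (l.map some ++ none :: I) R b v s a x).head (ih (some x :: R) _)
    simpa [add_assoc, add_comm 1] using this

theorem run_readRow (l : List Bool) (I R : List Symbol) (b v s a : ℕ) :
    Run (l.length + 1) (cfg readRow (l.map some ++ none :: I) R b v s a)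
      (cfg readWeight I (none :: (l.map some).reverse ++ R) b v (s + 1) a) := by
  induction l generalizing R with
  | nil => exact step_readRow_sep I R b v s a
  | cons x l ih =>
    have := (step_readRow_bit (l.map some ++ none :: I) R b v s a x).head (ih (some x :: R))
    simpa using this

theorem run_resetWeight (I R : List Symbol) (b v s a : ℕ) :
    Run (a + 1) (cfg resetWeight I R b v s a) (cfg readRow I R (b + a) v s 0) := by
  induction a generalizing b with
  | zero => exact step_resetWeight_zero I R b v s
  | succ a ih =>
    have := (step_resetWeight_succ I R b v s a).head (ih (b + 1))
    rwa [add_right_comm b] at this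

theorem run_readWeight (l : List Bool) (I R : List Symbol) (b v s a : ℕ) :
    Run (l.length + 1) (cfg readWeight (l.map some ++ none :: I) R (b + l.length) v s a)
      (cfg resetWeight I (none :: (l.map some).reverse ++ R) b v (s + 1) (a + l.length)) := by
  induction l generalizing R a with
  | nil => exact step_readWeight_sep I R b v s a
  | cons x l ih =>
    have := (step_readWeight_bit (l.map some ++ none :: I) R (b + l.length) v s a x).head
      (ih (some x :: R) _)
    simpa [add_assoc, add_comm 1] using this

/-- The remaining stacks are about to be erased, so only their sizes matter. -/
theorem run_readWeight_long (l : List Bool) (I R : List Symbol) (b v s a : ℕ)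
    (h : b < l.length) :
    ∃ I' R' a', Run (l.length + 1) (cfg readWeight (l.map some ++ none :: I) R b v s a)
        (cfg clear I' R' 0 v s a') ∧
      I'.length + R'.length = I.length + R.length + l.length + 1 ∧ a' = a + b := by
  induction l generalizing R b a with
  | nil => simp at h
  | cons x l ih =>
    cases b with
    | zero =>
      refine ⟨_, _, _, (step_readWeight_long (l.map some ++ none :: I) R v s a x).mono (by simp),
        ?_, rfl⟩
      simp
      lia
    | succ b =>
      obtain ⟨I', R', a', hrun, hlen, ha⟩ := ih (some x :: R) b (a + 1) (by simpa using h)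
      refine ⟨I', R', a', (step_readWeight_bit (l.map some ++ none :: I) R b v s a x).head hrun,
        ?_, by lia⟩
      simp at hlen ⊢
      lia

/-- The string describing an equation, given by its coefficients and its weight. -/
def equationString (e : List Bool × List Bool) : List Symbol :=
  e.1.map some ++ none :: (e.2.map some ++ [none])

theorem length_equationString (e : List Bool × List Bool) :
    (equationString e).length = e.1.length + e.2.length + 2 := by
  simp [equationString]
  lia

theorem run_equation (e : List Bool × List Bool) (I R : List Symbol) (b v s : ℕ)
    (h : e.2.length ≤ b) :
    Run (2 * (equationString e).length) (cfg readRow (equationString e ++ I) R b v s 0)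
      (cfg readRow I ((equationString e).reverse ++ R) b v (s + 2) 0) := by
  obtain ⟨b, rfl⟩ := Nat.exists_eq_add_of_le' h
  have h := ((run_readRow e.1 (e.2.map some ++ none :: I) R (b + e.2.length) v s 0).trans
    (run_readWeight e.2 I _ b v (s + 1) 0)).trans (run_resetWeight I _ b v (s + 2) (0 + e.2.length))
  rw [length_equationString]
  simp only [zero_add] at h
  refine Run.mono (t := e.1.length + 1 + (e.2.length + 1) + (e.2.length + 1)) ?_ ?_
  · convert h using 2 <;> simp [equationString]
  · lia

theorem run_equation_long (e : List Bool × List Bool) (I R : List Symbol) (b v s : ℕ)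
    (h : b < e.2.length) :
    ∃ I' R' a', Run (2 * (equationString e).length) (cfg readRow (equationString e ++ I) R b v s 0)
        (cfg clear I' R' 0 v (s + 1) a') ∧
      I'.length + R'.length = I.length + R.length + (equationString e).length ∧ a' = b := by
  obtain ⟨I', R', a', hrun, hlen, ha⟩ := run_readWeight_long e.2 I
    (none :: (e.1.map some).reverse ++ R) b v (s + 1) 0 h
  refine ⟨I', R', a', ?_, ?_, by lia⟩
  · have h := (run_readRow e.1 (e.2.map some ++ none :: I) R b v s 0).trans hrun
    refine Run.mono (t := e.1.length + 1 + (e.2.length + 1)) ?_ ?_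
    · convert h using 2
      simp [equationString]
    · rw [length_equationString]; lia
  · rw [hlen, length_equationString]
    simp
    lia

theorem run_equations (E : List (List Bool × List Bool)) (R : List Symbol) (b v s : ℕ)
    (h : ∀ e ∈ E, e.2.length ≤ b) :
    Run (2 * (E.flatMap equationString).length + 1)
      (cfg readRow (E.flatMap equationString) R b v s 0)
      (cfg (loop false) [] ((E.flatMap equationString).reverse ++ R) b v (s + 2 * E.length) 0) := by
  induction E generalizing R s with
  | nil => exact step_readRow_end R b v s 0
  | cons e E ih =>
    have := (run_equation e (E.flatMap equationString) R b v s (h e (by simp))).trans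
      (ih _ (s + 2) fun e' he' => h e' (by simp [he']))
    rw [List.length_cons, List.flatMap_cons, List.length_append, List.reverse_append,
      List.append_assoc, show s + 2 * (E.length + 1) = s + 2 + 2 * E.length by lia]
    exact this.mono (by lia)

theorem run_equations_long (E : List (List Bool × List Bool)) (R : List Symbol) (b v s : ℕ)
    (h : ∃ e ∈ E, b < e.2.length) :
    ∃ I' R' s' a', Run (2 * (E.flatMap equationString).length)
        (cfg readRow (E.flatMap equationString) R b v s 0) (cfg clear I' R' 0 v s' a') ∧
      I'.length + R'.length = R.length + (E.flatMap equationString).length ∧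
      s' ≤ s + 2 * E.length ∧ a' = b := by
  induction E generalizing R s with
  | nil => simp at h
  | cons e E ih =>
    by_cases he : b < e.2.length
    · obtain ⟨I', R', a', hrun, hlen, ha⟩ :=
        run_equation_long e (E.flatMap equationString) R b v s he
      refine ⟨I', R', _, a', hrun.mono ?_, ?_, ?_, ha⟩
      · rw [List.flatMap_cons, List.length_append]; lia
      · rw [List.flatMap_cons, List.length_append]; lia
      · rw [List.length_cons]; lia
    · obtain ⟨I', R', s', a', hrun, hlen, hs, ha⟩ := ih ((equationString e).reverse ++ R) (s + 2) (by
        obtain ⟨e', he', hlt⟩ := h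
        rcases List.mem_cons.1 he' with rfl | he'
        · exact absurd hlt he
        · exact ⟨e', he', hlt⟩)
      refine ⟨I', R', s', a',
        ((run_equation e (E.flatMap equationString) R b v s (not_lt.1 he)).trans hrun).mono ?_,
        ?_, ?_, ha⟩
      · rw [List.flatMap_cons, List.length_append]; lia
      · rw [List.length_append, List.length_reverse] at hlen
        rw [List.flatMap_cons, List.length_append]
        lia
      · rw [List.length_cons]; lia

theorem two_mul_length_le (E : List (List Bool × List Bool)) :
    2 * E.length ≤ (E.flatMap equationString).length := by
  induction E with
  | nil => simp
  | cons e E ih =>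
    rw [List.flatMap_cons, List.length_append, length_equationString, List.length_cons]
    lia

/-- The string describing an instance. -/
def inputString (l u : List Bool) (E : List (List Bool × List Bool)) : List Symbol :=
  l.map some ++ none :: (u.map some ++ none :: E.flatMap equationString)

/-- The separators number `2 * E.length + 2`: two per equation, one after the parameter and one
after the variables. Halving this count `q` times leaves zero exactly when it is below `2 ^ q`. -/
theorem run_program (l u : List Bool) (E : List (List Bool × List Bool)) (O : List Symbol)
    (h₁ : (∃ e ∈ E, l.length < e.2.length) ∨ 2 * E.length + 2 < 2 ^ (u.length / 2 ^ l.length) →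
      O = [none, none])
    (h₂ : ¬ ((∃ e ∈ E, l.length < e.2.length) ∨
      2 * E.length + 2 < 2 ^ (u.length / 2 ^ l.length)) → O = inputString l u E) :
    Run (4 * ((inputString l u E).length + 3) ^ 2) (cfg readParam (inputString l u E) [] 0 0 0 0)
      (final O) := by
  set N := (inputString l u E).length with hN
  have hlen : N = l.length + u.length + (E.flatMap equationString).length + 2 := by
    simp only [hN, inputString, List.length_append, List.length_cons, List.length_map]
    lia
  have hE := two_mul_length_le E
  have hread := (run_readParam l (u.map some ++ none :: E.flatMap equationString) [] 0 0 0 0).trans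
    (run_readVars u (E.flatMap equationString) (none :: (l.map some).reverse ++ []) (0 + l.length)
      0 1 0)
  simp only [zero_add] at hread
  by_cases hlong : ∃ e ∈ E, l.length < e.2.length
  · rw [h₁ (.inl hlong)]
    obtain ⟨I', R', s', a', hrun, hl, hs, ha⟩ := run_equations_long E
      (none :: (u.map some).reverse ++ (none :: (l.map some).reverse ++ [])) l.length u.length
      (1 + 1) hlong
    simp only [List.length_append, List.length_cons, List.length_map, List.length_reverse,
      List.length_nil] at hl
    refine ((hread.trans hrun).trans (run_clear N I' R' 0 u.length s' a' ?_ ?_ ?_ ?_ ?_ ?_)).mono ?_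
    iterate 6 lia
    nlinarith
  · have hrun := run_equations E
      (none :: (u.map some).reverse ++ (none :: (l.map some).reverse ++ [])) l.length u.length
      (1 + 1) fun e he => not_lt.1 fun hlt => hlong ⟨e, he, hlt⟩
    have hR : (E.flatMap equationString).reverse ++
        (none :: (u.map some).reverse ++ (none :: (l.map some).reverse ++ [])) =
        (inputString l u E).reverse := by simp [inputString]
    rw [hR] at hrun
    have hloop := (run_loop (inputString l u E).reverse false l.length u.length
      (1 + 1 + 2 * E.length)).trans (run_loop (inputString l u E).reverse true
        (u.length / 2 ^ l.length) (1 + 1 + 2 * E.length) 0)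
    have hall := (hread.trans hrun).trans hloop
    have hdiv : u.length / 2 ^ l.length ≤ u.length := Nat.div_le_self _ _
    have hb1 : l.length * (u.length + 3) ≤ l.length * (N + 3) := Nat.mul_le_mul_left _ (by lia)
    have hb2 : u.length / 2 ^ l.length * (1 + 1 + 2 * E.length + 3) ≤ u.length * (N + 3) :=
      Nat.mul_le_mul hdiv (by lia)
    have hb3 : l.length * (N + 3) + u.length * (N + 3) ≤ N * (N + 3) := by
      rw [← add_mul]
      exact Nat.mul_le_mul_right _ (by lia)
    set q := u.length / 2 ^ l.length with hq
    by_cases hzero : (1 + 1 + 2 * E.length) / 2 ^ q = 0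
    · rw [h₁ (.inr ?_)]
      · rw [hzero] at hall
        refine ((hall.trans (step_test_zero [] _ 0 0 0)).trans
          (run_clear N [] _ 0 0 0 0 ?_ ?_ ?_ ?_ ?_ ?_)).mono ?_
        · simp
        · simp [hN]
        iterate 4 lia
        nlinarith
      · rw [Nat.div_eq_zero_iff] at hzero
        have := Nat.two_pow_pos q
        lia
    · rw [h₂ ?_]
      · obtain ⟨r, hr⟩ := Nat.exists_eq_succ_of_ne_zero hzero
        have hrle : r < 1 + 1 + 2 * E.length := by
          have := Nat.div_le_self (1 + 1 + 2 * E.length) (2 ^ q)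
          lia
        rw [hr] at hall
        have := ((hall.trans (step_test_succ [] _ 0 0 r 0)).trans (run_drain _ r)).trans
          (run_restore [] (inputString l u E).reverse)
        rw [List.reverse_reverse, List.append_nil, List.length_reverse] at this
        refine this.mono ?_
        nlinarith
      · rw [not_or]
        refine ⟨hlong, fun hlt => hzero (Nat.div_eq_of_lt (by lia))⟩

end MaxLinAA.KernelMachine

/-! ### The bundled machine and lengths of encodings -/

namespace MaxLinAA.KernelMachine

open MaxLinSystem (Symbol)

/-- The kernelization machine. -/
def machine : Turing.FinTM2 where
  K := Stack
  k₀ := .inp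
  k₁ := .inp
  Γ _ := Symbol
  Λ := Label
  main := .readParam
  σ := Option Symbol
  initialState := none
  Γk₀Fin := inferInstanceAs (Fintype Symbol)
  m := program

theorem initList_eq (s : List Symbol) :
    Turing.initList machine s = cfg .readParam s [] 0 0 0 0 := by
  refine congrArg (Turing.TM2.Cfg.mk _ _) (funext fun k => ?_)
  cases k <;> rfl

theorem haltList_eq (s : List Symbol) : Turing.haltList machine s = final s := by
  refine congrArg (Turing.TM2.Cfg.mk _ _) (funext fun k => ?_)
  cases k <;> rfl

theorem nonempty_outputs {t : ℕ} {s s' : List Symbol}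
    (h : Run t (cfg .readParam s [] 0 0 0 0) (final s')) :
    Nonempty (Turing.TM2OutputsInTime machine
      (List.map (Equiv.refl Symbol).invFun s : List Symbol)
      (some (List.map (Equiv.refl Symbol).invFun s' : List Symbol)) t) := by
  have hid : ∀ l : List Symbol, l.map (Equiv.refl Symbol).invFun = l := List.map_id
  rw [hid, hid]
  obtain ⟨n, hn, e⟩ := h
  refine ⟨⟨⟨n, ?_⟩, hn⟩⟩
  rw [initList_eq]
  exact e.trans (congrArg some (haltList_eq s').symm)

end MaxLinAA.KernelMachine

theorem Computability.length_encodeNat (n : ℕ) : (encodeNat n).length = n.size := by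
  have hpos : ∀ p : PosNum, (encodePosNum p).length = p.natSize := by
    intro p
    induction p with
    | one => rfl
    | bit0 p ih => simp [encodePosNum, PosNum.natSize, ih]
    | bit1 p ih => simp [encodePosNum, PosNum.natSize, ih]
  have hnum : ∀ m : Num, (encodeNum m).length = m.natSize := by
    intro m
    cases m with
    | zero => rfl
    | pos p => exact hpos p
  rw [encodeNat, hnum, Num.natSize_to_nat, Num.to_of_nat]

namespace MaxLinSystem

theorem maxExcess_nonneg_of_isEmpty (S : MaxLinSystem) (h : S.m = 0) : 0 ≤ S.maxExcess := by
  have : IsEmpty (Fin S.m) := by rw [h]; infer_instance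
  refine le_trans ?_ (Finset.le_sup' S.excess (Finset.mem_univ 0))
  simp [excess]

/-- The coefficients together with the right-hand side, and the weight of an equation. -/
def equationData (S : MaxLinSystem) (j : Fin S.m) : List Bool × List Bool :=
  ((List.ofFn fun i => decide (S.A j i = 1)) ++ [decide (S.b j = 1)],
    Computability.encodeNat (S.w j))

theorem encodeEquation_eq (S : MaxLinSystem) (j : Fin S.m) :
    S.encodeEquation j = MaxLinAA.KernelMachine.equationString (S.equationData j) := by
  simp [encodeEquation, MaxLinAA.KernelMachine.equationString, equationData, List.map_ofFn,
    Function.comp_def]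

theorem length_encodeEquation (S : MaxLinSystem) (j : Fin S.m) :
    (S.encodeEquation j).length = S.n + 3 + (S.w j).size := by
  simp [encodeEquation, Computability.length_encodeNat]
  lia

theorem length_encode_le (S : MaxLinSystem) {L : ℕ} (h : ∀ j, (S.w j).size ≤ L) :
    S.encode.length ≤ S.n + 1 + S.m * (S.n + 3 + L) := by
  have : (((List.finRange S.m).map fun j => (S.encodeEquation j).length)).sum ≤
      S.m * (S.n + 3 + L) := by
    have h := List.sum_le_card_nsmul
      ((List.finRange S.m).map fun j => (S.encodeEquation j).length) (S.n + 3 + L) ?_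
    · simpa using h
    · intro x hx
      obtain ⟨j, -, rfl⟩ := List.mem_map.1 hx
      rw [length_encodeEquation]
      have := h j
      lia
  rw [encode, List.length_append, List.length_append, List.length_replicate, List.length_flatMap,
    List.length_singleton]
  lia

end MaxLinSystem

/-! ### The kernel: correctness, computability and size -/

namespace MaxLinAA

open KernelMachine

variable {p : ℕ → ℝ}

theorem Instance.encode_eq (I : Instance p) :
    I.encode = inputString (Computability.encodeNat I.k) (List.replicate I.system.n true)
      ((List.finRange I.system.m).map I.system.equationData) := by
  have : I.system.encodeEquation = equationString ∘ I.system.equationData :=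
    funext I.system.encodeEquation_eq
  simp [Instance.encode, MaxLinSystem.encode, inputString, List.flatMap_map, this,
    Function.comp_def]

/-- The condition under which an instance is recognized as a yes-instance. -/
def Instance.Trivial (I : Instance p) : Prop :=
  (∃ j, I.k.size < (I.system.w j).size) ∨
    -- `2 ^ I.k.size` replaces `k`: it exceeds `k`, is at most `2 * (k + 1)`, and division by it is
    -- repeated halving.
    2 * I.system.m + 2 < 2 ^ (I.system.n / 2 ^ I.k.size)

/-- The empty system with parameter `0`. -/
def emptyInstance (p : ℕ → ℝ) : Instance p where
  system :=
    { n := 0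
      m := 0
      A := 0
      b := 0
      w := 0
      w_pos := fun j => j.elim0
      row_ne_zero := fun j => j.elim0 }
  k := 0
  irreducible := ⟨Matrix.rank_zero, fun j => j.elim0⟩
  m_lt := by
    rw [Nat.cast_zero]
    exact Real.rpow_pos_of_pos two_pos _

theorem emptyInstance_isYes : (emptyInstance p).IsYes :=
  MaxLinSystem.maxExcess_nonneg_of_isEmpty _ rfl

theorem emptyInstance_encode : (emptyInstance p).encode = [none, none] := rfl

theorem Instance.Trivial.isYes {I : Instance p} (h : I.Trivial) : I.IsYes := by
  rcases h with ⟨j, hj⟩ | h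
  · refine le_trans ?_ (MaxLinSystem.w_le_maxExcess I.irreducible j)
    have h1 := Nat.lt_size_self I.k
    have h2 := Nat.lt_size.1 hj
    exact_mod_cast (h1.trans_le h2).le
  · refine MaxLinSystem.le_maxExcess_of_pow_lt I.irreducible ?_
    calc (I.system.m + 1) ^ I.k ≤ (I.system.m + 1) ^ 2 ^ I.k.size :=
          Nat.pow_le_pow_right (Nat.succ_pos _) (Nat.lt_size_self I.k).le
      _ < (2 ^ (I.system.n / 2 ^ I.k.size)) ^ 2 ^ I.k.size :=
          Nat.pow_lt_pow_left (by lia) (Nat.two_pow_pos _).ne'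
      _ = 2 ^ (I.system.n / 2 ^ I.k.size * 2 ^ I.k.size) := (pow_mul _ _ _).symm
      _ ≤ 2 ^ I.system.n := Nat.pow_le_pow_right two_pos (Nat.div_mul_le_self _ _)

/-- Since `1 ≤ 2 ^ |x|`, the number `2 * m + 2` is below `4 * 2 ^ |x|`. The absolute value covers
negative exponents. -/
theorem size_lt_of_lt_two_rpow {m : ℕ} {x : ℝ} (h : (m : ℝ) < 2 ^ x) :
    ((2 * m + 2).size : ℝ) < |x| + 3 := by
  obtain ⟨s, hs⟩ := Nat.exists_eq_succ_of_ne_zero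
    (Nat.size_eq_zero.not.2 (show 2 * m + 2 ≠ 0 by lia))
  have h1 : 2 ^ s ≤ 2 * m + 2 := Nat.lt_size.1 (by lia)
  have h2 : ((2 ^ s : ℕ) : ℝ) ≤ ((2 * m + 2 : ℕ) : ℝ) := by exact_mod_cast h1
  push_cast at h2
  have h3 : (2 : ℝ) ^ x ≤ 2 ^ |x| := Real.rpow_le_rpow_of_exponent_le one_le_two (le_abs_self x)
  have h4 : (1 : ℝ) ≤ 2 ^ |x| := Real.one_le_rpow one_le_two (abs_nonneg x)
  have h5 : (2 : ℝ) ^ (|x| + 2) = 2 ^ |x| * 4 := by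
    rw [Real.rpow_add two_pos]
    norm_num
  have h6 : (2 : ℝ) ^ (s : ℝ) < 2 ^ (|x| + 2) := by
    rw [Real.rpow_natCast, h5]
    linarith
  have h7 := (Real.rpow_lt_rpow_left_iff one_lt_two).1 h6
  rw [hs]
  push_cast
  linarith

theorem two_pow_size_le (k : ℕ) : 2 ^ k.size ≤ 2 * (k + 1) := by
  rcases h : k.size with _ | s
  · rw [pow_zero]
    lia
  · have : 2 ^ s ≤ k := Nat.lt_size.1 (by lia)
    rw [pow_succ]
    lia

theorem Instance.n_le_of_not_trivial {I : Instance p} (h : ¬ I.Trivial) :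
    (I.system.n : ℝ) ≤ (|p I.system.n| + 3) * (2 * (I.k + 1)) := by
  have h1 : 2 ^ (I.system.n / 2 ^ I.k.size) ≤ 2 * I.system.m + 2 :=
    not_lt.1 fun hlt => h (.inr hlt)
  have h2 := (Nat.div_lt_iff_lt_mul (Nat.two_pow_pos _)).1 (Nat.lt_size.2 h1)
  have h3 := h2.le.trans (Nat.mul_le_mul_left _ (two_pow_size_le I.k))
  have h4 : (I.system.n : ℝ) ≤ (2 * I.system.m + 2).size * (2 * (I.k + 1)) := by exact_mod_cast h3
  exact h4.trans (mul_le_mul_of_nonneg_right (size_lt_of_lt_two_rpow I.m_lt).le (by positivity))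

open Classical in
/-- Replace the instances that are recognized as yes-instances by the empty one. -/
noncomputable def kernel (I : Instance p) : Instance p :=
  if I.Trivial then emptyInstance p else I

theorem nonempty_computable_kernel :
    Nonempty (Turing.TM2ComputableInPolyTime
      (Instance.encode (p := p)) (Instance.encode (p := p)) kernel) := by
  have hout : ∀ I : Instance p, Nonempty (Turing.TM2OutputsInTime machine
      (List.map (Equiv.refl _).invFun I.encode)
      (some (List.map (Equiv.refl _).invFun (kernel I).encode)) (4 * (I.encode.length + 3) ^ 2)) := by
    intro I
    refine nonempty_outputs ?_
    have key : ((∃ e ∈ (List.finRange I.system.m).map I.system.equationData,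
          (Computability.encodeNat I.k).length < e.2.length) ∨
        2 * ((List.finRange I.system.m).map I.system.equationData).length + 2 <
          2 ^ ((List.replicate I.system.n true).length / 2 ^ (Computability.encodeNat I.k).length)) ↔
        I.Trivial := by
      simp [Instance.Trivial, MaxLinSystem.equationData, Computability.length_encodeNat]
    rw [I.encode_eq]
    refine run_program _ _ _ _ (fun h => ?_) (fun h => ?_)
    · rw [kernel, if_pos (key.1 h), emptyInstance_encode]
    · rw [kernel, if_neg (key.not.1 h), I.encode_eq]
  exact ⟨{
    tm := machine
    inputAlphabet := Equiv.refl _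
    outputAlphabet := Equiv.refl _
    time := 4 * (Polynomial.X + 3) ^ 2
    outputsFun := fun I => by
      have ht : (4 * (Polynomial.X + 3) ^ 2 : Polynomial ℕ).eval I.encode.length =
          4 * (I.encode.length + 3) ^ 2 := by simp
      rw [ht]
      exact (hout I).some }⟩

/-- As `1 ≤ x ^ a`, the summand `3` is absorbed into `3 * x ^ a`; dividing by `x ^ a` leaves a bound
on `x ^ (1 - a)`. -/
theorem le_rpow_of_le_mul {a C K : ℝ} (ha₀ : 0 < a) (ha₁ : a < 1) (hC : 0 ≤ C) (hK : 0 ≤ K)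
    {x y : ℝ} (hx : 1 ≤ x) (hy : y ≤ C * x ^ a) (h : x ≤ (y + 3) * K) :
    x ≤ ((C + 3) * K) ^ (1 / (1 - a)) := by
  have hx0 : 0 < x := one_pos.trans_le hx
  have h1 : 1 ≤ x ^ a := Real.one_le_rpow hx ha₀.le
  have h2 : x ^ (1 - a) * x ^ a = x := by
    rw [← Real.rpow_add hx0, sub_add_cancel, Real.rpow_one]
  have h3 : x ≤ (C + 3) * K * x ^ a := by
    have : (y + 3) * K ≤ ((C + 3) * x ^ a) * K :=
      mul_le_mul_of_nonneg_right (by linarith) hK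
    linarith
  have h4 : x ^ (1 - a) ≤ (C + 3) * K :=
    le_of_mul_le_mul_right (h2.le.trans h3) (Real.rpow_pos_of_pos hx0 a)
  rw [one_div]
  exact (Real.le_rpow_inv_iff_of_pos hx0.le (by positivity) (sub_pos.2 ha₁)).2 h4

theorem isBigO_add_rpow (N D : ℝ) (hN : 0 ≤ N) (hD : 0 ≤ D) {e : ℝ} (he : 0 ≤ e) :
    (fun k : ℕ => N + (D * (k + 1)) ^ e) =O[atTop] fun k : ℕ => (k : ℝ) ^ e := by
  refine IsBigO.of_bound (N + (D * 2) ^ e) ?_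
  filter_upwards [eventually_ge_atTop 1] with k hk
  have hk1 : (1 : ℝ) ≤ k := by exact_mod_cast hk
  have h1 : (1 : ℝ) ≤ (k : ℝ) ^ e := Real.one_le_rpow hk1 he
  have h2 : (D * (k + 1)) ^ e ≤ (D * 2) ^ e * (k : ℝ) ^ e := by
    rw [← Real.mul_rpow (by positivity) (by positivity)]
    refine Real.rpow_le_rpow (by positivity) ?_ he
    nlinarith
  rw [Real.norm_of_nonneg (by positivity), Real.norm_of_nonneg (by positivity), add_mul]
  nlinarith

end MaxLinAA

theorem mainTheorem10 (a : ℝ) (ha₀ : 0 < a) (ha₁ : a < 1)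
    (p : ℕ → ℝ) (hp : p =O[atTop] fun n : ℕ => (n : ℝ) ^ a) :
    ∃ κ : MaxLinAA.Instance p → MaxLinAA.Instance p,
      MaxLinAA.IsKernelization κ ∧
      ∃ h : ℕ → ℝ, (h =O[atTop] fun k : ℕ => (k : ℝ) ^ (1 / (1 - a))) ∧
        ∀ I : MaxLinAA.Instance p, ((κ I).system.n : ℝ) ≤ h I.k := by
  obtain ⟨C, hC, hbound⟩ := hp.exists_nonneg
  obtain ⟨N, hN⟩ := eventually_atTop.1 hbound.bound
  have he : 0 ≤ 1 / (1 - a) := one_div_nonneg.2 (sub_nonneg.2 ha₁.le)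
  -- The summand `N` covers the small `n`, for which the asymptotic bound on `p` says nothing.
  set h : ℕ → ℝ := fun k => N + ((C + 3) * 2 * (k + 1)) ^ (1 / (1 - a)) with hh
  have hrpow : ∀ k : ℕ, 0 ≤ ((C + 3) * 2 * (k + 1)) ^ (1 / (1 - a)) := fun k => by positivity
  have hn : ∀ I : MaxLinAA.Instance p, ¬ I.Trivial → (I.system.n : ℝ) ≤ h I.k := by
    intro I hI
    by_cases hlarge : N ≤ I.system.n ∧ 1 ≤ I.system.n
    · have h1 := hN I.system.n hlarge.1
      rw [Real.norm_eq_abs, Real.norm_of_nonneg (by positivity)] at h1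
      have h2 := MaxLinAA.le_rpow_of_le_mul ha₀ ha₁ hC (K := 2 * (I.k + 1)) (by positivity)
        (by exact_mod_cast hlarge.2) h1 (MaxLinAA.Instance.n_le_of_not_trivial hI)
      rw [← mul_assoc] at h2
      exact h2.trans (le_add_of_nonneg_left (Nat.cast_nonneg N))
    · have : (I.system.n : ℝ) ≤ N := by
        exact_mod_cast (show I.system.n ≤ N by lia)
      exact this.trans (le_add_of_nonneg_right (hrpow _))
  have hkernel : ∀ {P : MaxLinAA.Instance p → Prop} (I : MaxLinAA.Instance p),
      (I.Trivial → P (MaxLinAA.emptyInstance p)) → (¬ I.Trivial → P I) →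
      P (MaxLinAA.kernel I) := by
    intro P I h1 h2
    unfold MaxLinAA.kernel
    split_ifs with hI
    exacts [h1 hI, h2 hI]
  refine ⟨MaxLinAA.kernel, ⟨MaxLinAA.nonempty_computable_kernel, fun I => ?_, ⟨id, fun I => ?_⟩,
    -- This is the bound of `length_encode_le` with `n ≤ ⌊h k⌋₊`, `m ≤ 2 ^ n` and weights of at most
    -- `k.size` bits.
    ⟨fun k => ⌊h k⌋₊ + 1 + 2 ^ ⌊h k⌋₊ * (⌊h k⌋₊ + 3 + k.size), fun I => ?_⟩⟩, h,
    MaxLinAA.isBigO_add_rpow N _ (Nat.cast_nonneg N) (by positivity) he, fun I => ?_⟩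
  · exact hkernel (P := fun J => I.IsYes ↔ J.IsYes) I
      (fun hI => iff_of_true hI.isYes MaxLinAA.emptyInstance_isYes) fun _ => Iff.rfl
  · exact hkernel (P := fun J => J.k ≤ I.k) I (fun _ => Nat.zero_le _) fun _ => le_rfl
  · refine hkernel (P := fun J => J.system.encode.length ≤ _) I (fun _ => ?_) fun hI => ?_
    · exact le_trans (b := 1) le_rfl (by lia)
    · have h1 : I.system.n ≤ ⌊h I.k⌋₊ := Nat.le_floor (hn I hI)
      have h2 : I.system.m ≤ 2 ^ ⌊h I.k⌋₊ :=
        (MaxLinSystem.m_le_two_pow I.irreducible).trans (Nat.pow_le_pow_right two_pos h1)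
      refine (I.system.length_encode_le fun j => not_lt.1 fun hlt => hI (.inl ⟨j, hlt⟩)).trans ?_
      beta_reduce
      gcongr
  · refine hkernel (P := fun J => (J.system.n : ℝ) ≤ h I.k) I (fun _ => ?_) (hn I)
    exact le_trans (le_of_eq Nat.cast_zero) (add_nonneg (Nat.cast_nonneg N) (hrpow _))
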